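/- Let $\rho\in\mathbb R$ and let $\kappa:[0,\infty)\to\mathbb R$ be concave, non-decreasing and $\rho$-Lipschitz smooth (i.e. differentiable, with the one-sided derivative at $0$, and $|\kappa'(s)-\kappa'(t)|\le\rho|s-t|$ for all $s,t\ge 0$), with $\kappa'$ non-differentiable at no more than finitely many points, and with $\kappa(0)=0$. Put $\kappa_0=\kappa'(0)$ and let $\mu\ge 0$. For $X\in\mathbb R^{m\times n}$ let $\sigma_1(X)\ge\dots\ge\sigma_r(X)\ge 0$, $r=\min(m,n)$, be its singular values, $\|X\|_*=\sum_{i=1}^r\sigma_i(X)$ its nuclear norm and $\|X\|_F$ its Frobenius norm. Then the regularizer $g(X)=\mu\sum_{i=1}^r\kappa(\sigma_i(X))$ decomposes as $g(X)=\bar g(X)+\breve g(X)$ for all $X\in\mathbb R^{m\times n}$, where 1. $\bar g(X)=\mu\sum_{i=1}^r\kappa(\sigma_i(X))-\mu\kappa_0\|X\|_*$ is concave on $\mathbb R^{m\times n}$ and $2\mu\rho$-Lipschitz smooth, i.e. it is differentiable and $\|\nabla\bar g(X)-\nabla\bar g(Y)\|_F\le 2\mu\rho\,\|X-Y\|_F$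 for all $X,Y\in\mathbb R^{m\times n}$; if $\mu\le 2$ (in particular if $\mu=1$), it is also $2\rho$-Lipschitz smooth; 2. $\breve g(X)=\mu\kappa_0\|X\|_*$ is convex on $\mathbb R^{m\times n}$, and it is nonsmooth (not everywhere differentiable) provided that $m,n\ge 1$, $\mu>0$ and $\kappa_0>0$. -/

import Mathlib

attribute [local instance] Matrix.frobeniusNormedAddCommGroup Matrix.frobeniusNormedSpace

/-- The slope `κ'(t)` of a function `κ` on `[0, ∞)`; at `t = 0` it is the right derivative. -/
noncomputable def slopeOn (κ : ℝ → ℝ) (t : ℝ) : ℝ :=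
  derivWithin κ (Set.Ici 0) t

/-- The penalty functions `κ : [0, ∞) → ℝ`: concave, non-decreasing, `ρ`-Lipschitz smooth, with
`κ'` non-differentiable at no more than finitely many points, and `κ 0 = 0`. Only the values of `κ`
on `[0, ∞)` matter. -/
structure IsPenalty (κ : ℝ → ℝ) (ρ : ℝ) : Prop where
  concave : ConcaveOn ℝ (Set.Ici 0) κ
  mono : MonotoneOn κ (Set.Ici 0)
  differentiable : DifferentiableOn ℝ κ (Set.Ici 0)
  lipschitz : ∀ s t : ℝ, 0 ≤ s → 0 ≤ t → |slopeOn κ s - slopeOn κ t| ≤ ρ * |s - t|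
  finite_nondiff :
    {t : ℝ | 0 ≤ t ∧ ¬ DifferentiableWithinAt ℝ (slopeOn κ) (Set.Ici 0) t}.Finite
  map_zero : κ 0 = 0

/-- The singular values `σ₀(X) ≥ σ₁(X) ≥ …` of a real `m × n` matrix, counted with multiplicity
(those with index `< min m n` are the singular values of `X`). -/
noncomputable def sigma {m n : ℕ} (X : Matrix (Fin m) (Fin n) ℝ) (i : ℕ) : ℝ :=
  (Matrix.toEuclideanLin X).singularValues i

/-- The nuclear norm: the sum of the singular values. -/
noncomputable def nuclearNorm {m n : ℕ} (X : Matrix (Fin m) (Fin n) ℝ) : ℝ :=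
  ∑ i ∈ Finset.range (min m n), sigma X i

/-- The matrix regularizer `g(X) = μ ∑ᵢ κ(σᵢ(X))`. -/
noncomputable def gReg {m n : ℕ} (κ : ℝ → ℝ) (μ : ℝ) (X : Matrix (Fin m) (Fin n) ℝ) : ℝ :=
  μ * ∑ i ∈ Finset.range (min m n), κ (sigma X i)

/-- `ḡ(X) = μ ∑ᵢ κ(σᵢ(X)) - μ κ₀ ‖X‖_*`, where `κ₀ = κ'(0)`. -/
noncomputable def gBar {m n : ℕ} (κ : ℝ → ℝ) (μ : ℝ) (X : Matrix (Fin m) (Fin n) ℝ) : ℝ :=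
  μ * ∑ i ∈ Finset.range (min m n), κ (sigma X i) - μ * slopeOn κ 0 * nuclearNorm X

/-- `ğ(X) = μ κ₀ ‖X‖_*`, where `κ₀ = κ'(0)`. -/
noncomputable def gBreve {m n : ℕ} (κ : ℝ → ℝ) (μ : ℝ) (X : Matrix (Fin m) (Fin n) ℝ) : ℝ :=
  μ * slopeOn κ 0 * nuclearNorm X

/-- `G` is the gradient of `f` at `X` for the inner product `⟨G, H⟩ = ∑ᵢⱼ Gᵢⱼ Hᵢⱼ`. -/
def IsGradientAt {m n : ℕ} (f : Matrix (Fin m) (Fin n) ℝ → ℝ)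
    (G X : Matrix (Fin m) (Fin n) ℝ) : Prop :=
  ∃ f' : Matrix (Fin m) (Fin n) ℝ →L[ℝ] ℝ,
    (∀ H, f' H = ∑ i, ∑ j, G i j * H i j) ∧ HasFDerivAt f f' X

/-- `f` is `L`-Lipschitz smooth: it is differentiable everywhere and
`‖∇f(X) - ∇f(Y)‖_F ≤ L ‖X - Y‖_F`. The norm on matrices is the Frobenius norm. -/
def LipschitzSmooth {m n : ℕ} (f : Matrix (Fin m) (Fin n) ℝ → ℝ) (L : ℝ) : Prop :=
  ∃ grad : Matrix (Fin m) (Fin n) ℝ → Matrix (Fin m) (Fin n) ℝ,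
    (∀ X, IsGradientAt f (grad X) X) ∧ ∀ X Y, ‖grad X - grad Y‖ ≤ L * ‖X - Y‖

/-! ### Trace functions of symmetric matrices via eigenvector overlaps. -/

section TraceFunctions

open Matrix

variable {ι : Type*} [Fintype ι] [DecidableEq ι] {A B : Matrix ι ι ℝ}

/-! The symmetric dilation of `X` has eigenvalues `±σᵢ(X)` and zeros, so `∑ φ(σᵢ)` with `φ 0 = 0` is
half the trace of `φ(|·|)` at the dilation (`sum_eigenvalues_dilation`). The residual `κ(t) - κ'(0)
t` has zero slope at `0`, hence its even extension is differentiable on `ℝ`, with antitone and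
`ρ`-Lipschitz derivative.

Scalar bounds pass to matrices because `tr(f(A) g(B))` is a sum of `f(λᵢ) g(νⱼ)` with doubly
stochastic weights. `sum_eigenvalues_sub_sub_trace` transfers first-order remainders, giving
concavity and the gradient; `trace_cfc_sub_cfc_sq_le` transfers the Lipschitz bound. The result is
the constant `μρ`, which implies both stated ones.

The nuclear norm is half the trace of `|·|`, convex by the same remainder identity. At its minimum
`0` it dominates a multiple of the Frobenius norm, so it is not differentiable there. -/

theorem trace_conj_diagonal_mul_conj_diagonal (U V : Matrix ι ι ℝ) (p q : ι → ℝ) :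
    ((U * diagonal p * Uᵀ) * (V * diagonal q * Vᵀ)).trace =
      ∑ i, ∑ j, p i * q j * (Uᵀ * V) i j ^ 2 := by
  have h : ((U * diagonal p * Uᵀ) * (V * diagonal q * Vᵀ)).trace =
      ((diagonal p * (Uᵀ * V)) * (diagonal q * (Uᵀ * V)ᵀ)).trace := by
    rw [transpose_mul, transpose_transpose, Matrix.mul_assoc U, Matrix.mul_assoc U, trace_mul_comm]
    simp only [Matrix.mul_assoc]
  rw [h]
  simp only [trace, diag, Matrix.mul_apply (M := diagonal p * (Uᵀ * V)), diagonal_mul,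
    transpose_apply]
  exact Finset.sum_congr rfl fun i _ => Finset.sum_congr rfl fun j _ => by ring

/-- The squared inner products of the eigenvectors of two Hermitian matrices. -/
noncomputable def eigenOverlap (hA : A.IsHermitian) (hB : B.IsHermitian) (i j : ι) : ℝ :=
  ((hA.eigenvectorUnitary : Matrix ι ι ℝ)ᵀ * (hB.eigenvectorUnitary : Matrix ι ι ℝ)) i j ^ 2

theorem eigenOverlap_nonneg (hA : A.IsHermitian) (hB : B.IsHermitian) (i j : ι) :
    0 ≤ eigenOverlap hA hB i j := sq_nonneg _

theorem eigenvectorUnitary_transpose_mul_self (hA : A.IsHermitian) :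
    (hA.eigenvectorUnitary : Matrix ι ι ℝ)ᵀ * (hA.eigenvectorUnitary : Matrix ι ι ℝ) = 1 :=
  Unitary.coe_star_mul_self hA.eigenvectorUnitary

theorem eigenvectorUnitary_mul_transpose_self (hA : A.IsHermitian) :
    (hA.eigenvectorUnitary : Matrix ι ι ℝ) * (hA.eigenvectorUnitary : Matrix ι ι ℝ)ᵀ = 1 :=
  Unitary.coe_mul_star_self hA.eigenvectorUnitary

theorem eigenOverlap_comm (hA : A.IsHermitian) (hB : B.IsHermitian) (i j : ι) :
    eigenOverlap hA hB i j = eigenOverlap hB hA j i := by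
  unfold eigenOverlap
  rw [← transpose_apply (_ * _) j i, transpose_mul, transpose_transpose]

/-- The change of basis between two orthonormal eigenbases is orthogonal, so its rows have unit
length. -/
theorem sum_eigenOverlap_right (hA : A.IsHermitian) (hB : B.IsHermitian) (i : ι) :
    ∑ j, eigenOverlap hA hB i j = 1 := by
  set W := (hA.eigenvectorUnitary : Matrix ι ι ℝ)ᵀ * (hB.eigenvectorUnitary : Matrix ι ι ℝ)
    with hW
  have h : W * Wᵀ = 1 := by
    rw [hW, transpose_mul, transpose_transpose, Matrix.mul_assoc, ← Matrix.mul_assoc _ _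
      (hA.eigenvectorUnitary : Matrix ι ι ℝ), eigenvectorUnitary_mul_transpose_self,
      Matrix.one_mul, eigenvectorUnitary_transpose_mul_self]
  have h' := congrFun (congrFun h i) i
  rw [Matrix.mul_apply, one_apply_eq] at h'
  rw [← h']
  exact Finset.sum_congr rfl fun j _ => by rw [transpose_apply, ← sq]; rfl

theorem sum_eigenOverlap_left (hA : A.IsHermitian) (hB : B.IsHermitian) (j : ι) :
    ∑ i, eigenOverlap hA hB i j = 1 := by
  simp_rw [eigenOverlap_comm hA hB]
  exact sum_eigenOverlap_right hB hA j

theorem cfc_eq_conj_diagonal (hA : A.IsHermitian) (f : ℝ → ℝ) :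
    hA.cfc f = hA.eigenvectorUnitary * diagonal (f ∘ hA.eigenvalues) *
      (hA.eigenvectorUnitary : Matrix ι ι ℝ)ᵀ := rfl

theorem cfc_id_eq_self (hA : A.IsHermitian) : hA.cfc id = A :=
  hA.spectral_theorem.symm

theorem cfc_transpose (hA : A.IsHermitian) (f : ℝ → ℝ) : (hA.cfc f)ᵀ = hA.cfc f := by
  simp [cfc_eq_conj_diagonal, Matrix.mul_assoc]

theorem trace_cfc_mul_cfc (hA : A.IsHermitian) (hB : B.IsHermitian) (f g : ℝ → ℝ) :
    (hA.cfc f * hB.cfc g).trace =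
      ∑ i, ∑ j, f (hA.eigenvalues i) * g (hB.eigenvalues j) * eigenOverlap hA hB i j :=
  trace_conj_diagonal_mul_conj_diagonal _ _ _ _

theorem trace_cfc_mul_cfc_self (hA : A.IsHermitian) (f g : ℝ → ℝ) :
    (hA.cfc f * hA.cfc g).trace = ∑ i, f (hA.eigenvalues i) * g (hA.eigenvalues i) := by
  rw [trace_cfc_mul_cfc]
  refine Finset.sum_congr rfl fun i _ => ?_
  rw [Finset.sum_eq_single i]
  · simp [eigenOverlap, eigenvectorUnitary_transpose_mul_self]
  · intro j _ hj
    simp [eigenOverlap, eigenvectorUnitary_transpose_mul_self, one_apply_ne hj.symm]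
  · simp

/-- Puts a sum over one spectrum on the same weights as the mixed terms, so that identities can be
checked termwise. -/
theorem sum_left_eq_sum_eigenOverlap (hA : A.IsHermitian) (hB : B.IsHermitian) (a : ι → ℝ) :
    ∑ i, a i = ∑ i, ∑ j, a i * eigenOverlap hA hB i j := by
  simp_rw [← Finset.mul_sum, sum_eigenOverlap_right, mul_one]

theorem sum_right_eq_sum_eigenOverlap (hA : A.IsHermitian) (hB : B.IsHermitian) (b : ι → ℝ) :
    ∑ j, b j = ∑ i, ∑ j, b j * eigenOverlap hA hB i j := by
  rw [Finset.sum_comm]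
  simp_rw [← Finset.mul_sum, sum_eigenOverlap_left, mul_one]

/-- Klein's identity for the Bregman remainder of a trace function. -/
theorem sum_eigenvalues_sub_sub_trace (hA : A.IsHermitian) (hB : B.IsHermitian) (f d : ℝ → ℝ) :
    ∑ j, f (hB.eigenvalues j) - ∑ i, f (hA.eigenvalues i) - (hA.cfc d * (B - A)).trace =
      ∑ i, ∑ j, (f (hB.eigenvalues j) - f (hA.eigenvalues i) -
        d (hA.eigenvalues i) * (hB.eigenvalues j - hA.eigenvalues i)) *
          eigenOverlap hA hB i j := by
  have h : (hA.cfc d * (B - A)).trace =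
      (hA.cfc d * hB.cfc id).trace - (hA.cfc d * hA.cfc id).trace := by
    rw [cfc_id_eq_self, cfc_id_eq_self, Matrix.mul_sub, trace_sub]
  rw [h, trace_cfc_mul_cfc, trace_cfc_mul_cfc_self,
    sum_left_eq_sum_eigenOverlap hA hB (fun i => f (hA.eigenvalues i)),
    sum_left_eq_sum_eigenOverlap hA hB (fun i => d _ * id _),
    sum_right_eq_sum_eigenOverlap hA hB (fun i => f (hB.eigenvalues i))]
  simp only [← Finset.sum_sub_distrib]
  exact Finset.sum_congr rfl fun i _ => Finset.sum_congr rfl fun j _ => by simp only [id]; ring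

theorem trace_cfc_sub_cfc_sq (hA : A.IsHermitian) (hB : B.IsHermitian) (f : ℝ → ℝ) :
    ((hA.cfc f - hB.cfc f) * (hA.cfc f - hB.cfc f)).trace =
      ∑ i, ∑ j, (f (hA.eigenvalues i) - f (hB.eigenvalues j)) ^ 2 * eigenOverlap hA hB i j := by
  have h : ((hA.cfc f - hB.cfc f) * (hA.cfc f - hB.cfc f)).trace =
      (hA.cfc f * hA.cfc f).trace + (hB.cfc f * hB.cfc f).trace
        - 2 * (hA.cfc f * hB.cfc f).trace := by
    simp only [Matrix.mul_sub, Matrix.sub_mul, trace_sub, trace_mul_comm (hB.cfc f) (hA.cfc f)]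
    ring
  rw [h, trace_cfc_mul_cfc hA hB, trace_cfc_mul_cfc_self, trace_cfc_mul_cfc_self,
    sum_left_eq_sum_eigenOverlap hA hB (fun i => f (hA.eigenvalues i) * _),
    sum_right_eq_sum_eigenOverlap hA hB (fun i => f (hB.eigenvalues i) * _)]
  simp only [Finset.mul_sum, ← Finset.sum_sub_distrib, ← Finset.sum_add_distrib]
  exact Finset.sum_congr rfl fun i _ => Finset.sum_congr rfl fun j _ => by ring

theorem trace_sub_sq (hA : A.IsHermitian) (hB : B.IsHermitian) :
    ((A - B) * (A - B)).trace =
      ∑ i, ∑ j, (hA.eigenvalues i - hB.eigenvalues j) ^ 2 * eigenOverlap hA hB i j := by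
  have h := trace_cfc_sub_cfc_sq hA hB id
  rwa [cfc_id_eq_self, cfc_id_eq_self] at h

/-- Both sides are sums with the same nonnegative weights, so the scalar bound applies to each pair
of eigenvalues. -/
theorem trace_cfc_sub_cfc_sq_le (hA : A.IsHermitian) (hB : B.IsHermitian) {f : ℝ → ℝ} {L : ℝ}
    (hf : ∀ s t, |f s - f t| ≤ L * |s - t|) :
    ((hA.cfc f - hB.cfc f) * (hA.cfc f - hB.cfc f)).trace ≤
      L ^ 2 * ((A - B) * (A - B)).trace := by
  rw [trace_cfc_sub_cfc_sq, trace_sub_sq hA hB]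
  simp only [Finset.mul_sum, ← mul_assoc]
  refine Finset.sum_le_sum fun i _ => Finset.sum_le_sum fun j _ =>
    mul_le_mul_of_nonneg_right ?_ (eigenOverlap_nonneg _ _ _ _)
  rw [← sq_abs, ← sq_abs (hA.eigenvalues i - _), ← mul_pow]
  exact pow_le_pow_left₀ (abs_nonneg _) (hf _ _) 2

theorem trace_mul_self_eq_sum_sq_eigenvalues (hA : A.IsHermitian) :
    (A * A).trace = ∑ i, hA.eigenvalues i ^ 2 := by
  have h := trace_cfc_mul_cfc_self hA id id
  rw [cfc_id_eq_self] at h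
  simpa [sq] using h

theorem roots_charpoly_mul_self (hA : A.IsHermitian) :
    (A * A).charpoly.roots = Finset.univ.val.map fun i => hA.eigenvalues i ^ 2 := by
  have h : A * A = cfc (fun x : ℝ => x ^ 2) A := by
    rw [cfc_pow_id (R := ℝ) A 2 hA.isSelfAdjoint, sq]
  rw [h, hA.charpoly_cfc_eq, Polynomial.roots_prod _ _
    (Finset.prod_ne_zero_iff.2 fun i _ => Polynomial.X_sub_C_ne_zero _)]
  simp only [Polynomial.roots_X_sub_C, Multiset.bind_singleton]
  rfl

end TraceFunctions

/-! ### Singular values as eigenvalues of the dilation. -/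

section Dilation

open Matrix

variable {m n : ℕ}

theorem frobenius_norm_sq (X : Matrix (Fin m) (Fin n) ℝ) : ‖X‖ ^ 2 = ∑ i, ∑ j, X i j ^ 2 := by
  rw [frobenius_norm_def, ← Real.sqrt_eq_rpow, Real.sq_sqrt (by positivity)]
  simp

/-- The Hermitian dilation of a rectangular matrix. -/
def dilation (X : Matrix (Fin m) (Fin n) ℝ) : Matrix (Fin m ⊕ Fin n) (Fin m ⊕ Fin n) ℝ :=
  fromBlocks 0 X Xᵀ 0

theorem dilation_transpose (X : Matrix (Fin m) (Fin n) ℝ) : (dilation X)ᵀ = dilation X := by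
  simp [dilation, fromBlocks_transpose]

theorem dilation_isHermitian (X : Matrix (Fin m) (Fin n) ℝ) : (dilation X).IsHermitian := by
  rw [IsHermitian, conjTranspose_eq_transpose_of_trivial, dilation_transpose]

theorem dilation_sub (X Y : Matrix (Fin m) (Fin n) ℝ) :
    dilation (X - Y) = dilation X - dilation Y := by
  simp [dilation, sub_eq_add_neg, fromBlocks_neg, fromBlocks_add]

theorem trace_mul_dilation {M : Matrix (Fin m ⊕ Fin n) (Fin m ⊕ Fin n) ℝ} (hM : Mᵀ = M)
    (X : Matrix (Fin m) (Fin n) ℝ) :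
    (M * dilation X).trace = 2 * ∑ i, ∑ j, M.toBlocks₁₂ i j * X i j := by
  have hs : ∀ i j, M (Sum.inr j) (Sum.inl i) = M (Sum.inl i) (Sum.inr j) := fun i j =>
    congrFun (congrFun hM (Sum.inl i)) (Sum.inr j)
  simp only [trace, diag, Matrix.mul_apply, Fintype.sum_sum_type, dilation, fromBlocks_apply₁₁,
    fromBlocks_apply₂₁, fromBlocks_apply₁₂, fromBlocks_apply₂₂, Matrix.zero_apply, mul_zero,
    Finset.sum_const_zero, zero_add, add_zero, transpose_apply, hs, toBlocks₁₂, of_apply]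
  rw [Finset.sum_comm (γ := Fin n) (α := Fin m), two_mul]

theorem trace_dilation_mul_self (X : Matrix (Fin m) (Fin n) ℝ) :
    (dilation X * dilation X).trace = 2 * ‖X‖ ^ 2 := by
  rw [trace_mul_dilation (dilation_transpose X), frobenius_norm_sq]
  simp [dilation, sq]

/-- The two off-diagonal blocks contribute equally; the squares in the diagonal blocks are dropped.
-/
theorem two_mul_norm_toBlocks₁₂_sq_le {M : Matrix (Fin m ⊕ Fin n) (Fin m ⊕ Fin n) ℝ}
    (hM : Mᵀ = M) : 2 * ‖M.toBlocks₁₂‖ ^ 2 ≤ (M * M).trace := by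
  have hs : ∀ i j, M (Sum.inr j) (Sum.inl i) = M (Sum.inl i) (Sum.inr j) := fun i j =>
    congrFun (congrFun hM (Sum.inl i)) (Sum.inr j)
  have h : (M * M).trace = ∑ i, ∑ j, M i j ^ 2 := by
    simp only [trace, diag, Matrix.mul_apply]
    refine Finset.sum_congr rfl fun i _ => Finset.sum_congr rfl fun j _ => ?_
    rw [sq, ← congrFun (congrFun hM j) i, transpose_apply]
  rw [h, frobenius_norm_sq]
  simp only [Fintype.sum_sum_type, toBlocks₁₂, of_apply, Finset.sum_add_distrib, hs]
  rw [Finset.sum_comm (γ := Fin n) (α := Fin m)]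
  have h1 : 0 ≤ ∑ i, ∑ j, M (Sum.inl i) (Sum.inl j) ^ 2 := by positivity
  have h2 : 0 ≤ ∑ i, ∑ j, M (Sum.inr i) (Sum.inr j) ^ 2 := by positivity
  linarith

theorem charpoly_toEuclideanLin (M : Matrix (Fin n) (Fin n) ℝ) :
    (toEuclideanLin M).charpoly = M.charpoly := by
  rw [toEuclideanLin, toLpLin_eq_toLin, ← LinearMap.charpoly_toMatrix _ (PiLp.basisFun 2 ℝ (Fin n)),
    LinearMap.toMatrix_toLin]

theorem roots_charpoly_transpose_mul_self (X : Matrix (Fin m) (Fin n) ℝ) :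
    (Xᵀ * X).charpoly.roots = Finset.univ.val.map fun i : Fin n => sigma X i ^ 2 := by
  have e : (toEuclideanLin X).adjoint ∘ₗ toEuclideanLin X = toEuclideanLin (Xᵀ * X) := by
    rw [← conjTranspose_eq_transpose_of_trivial, ← toEuclideanLin_conjTranspose_eq_adjoint]
    ext v
    simp [toLpLin_apply]
  rw [← charpoly_toEuclideanLin, ← e,
    (toEuclideanLin X).isSymmetric_adjoint_comp_self.roots_charpoly_eq_eigenvalues
      finrank_euclideanSpace_fin]
  exact Multiset.map_congr rfl fun i _ =>
    ((toEuclideanLin X).sq_singularValues_fin finrank_euclideanSpace_fin i).symm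

theorem sigma_nonneg (X : Matrix (Fin m) (Fin n) ℝ) (i : ℕ) : 0 ≤ sigma X i :=
  LinearMap.singularValues_nonneg _ _

theorem sigma_eq_zero (X : Matrix (Fin m) (Fin n) ℝ) {i : ℕ} (hi : min m n ≤ i) :
    sigma X i = 0 := by
  unfold sigma
  rw [LinearMap.singularValues_eq_zero_iff_le_finrank_range]
  refine le_trans (le_min ?_ ?_) hi
  · simpa using (toEuclideanLin X).range.finrank_le
  · simpa using (toEuclideanLin X).finrank_range_le

theorem sum_range_sigma {φ : ℝ → ℝ} (h0 : φ 0 = 0) (X : Matrix (Fin m) (Fin n) ℝ) :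
    ∑ i ∈ Finset.range (min m n), φ (sigma X i) = ∑ i : Fin n, φ (sigma X i) := by
  rw [Fin.sum_univ_eq_sum_range (fun i => φ (sigma X i))]
  refine Finset.sum_subset (Finset.range_mono (min_le_right _ _)) fun i _ hi => ?_
  rw [sigma_eq_zero X (by rwa [Finset.mem_range, not_lt] at hi), h0]

/-- The eigenvalues of the dilation are `±σᵢ(X)` and zeros. -/
theorem sum_eigenvalues_dilation {φ : ℝ → ℝ} (h0 : φ 0 = 0) (X : Matrix (Fin m) (Fin n) ℝ) :
    ∑ k, φ |(dilation_isHermitian X).eigenvalues k| =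
      2 * ∑ i ∈ Finset.range (min m n), φ (sigma X i) := by
  have hsq : dilation X * dilation X = fromBlocks (X * Xᵀ) 0 0 (Xᵀ * X) := by
    simp [dilation, fromBlocks_multiply]
  -- Squaring the dilation makes it block diagonal, and `|λ| = √(λ²)` loses nothing for an even
  -- function.
  have hL : ∑ k, φ |(dilation_isHermitian X).eigenvalues k| =
      ((dilation X * dilation X).charpoly.roots.map fun x => φ √x).sum := by
    rw [roots_charpoly_mul_self (dilation_isHermitian X), Multiset.map_map]
    simp only [Function.comp_def, Real.sqrt_sq_eq_abs]
    rfl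
  have hR : ((Xᵀ * X).charpoly.roots.map fun x => φ √x).sum = ∑ i : Fin n, φ (sigma X i) := by
    rw [roots_charpoly_transpose_mul_self, Multiset.map_map]
    simp only [Function.comp_def, Real.sqrt_sq (sigma_nonneg X _)]
    rfl
  have hne : ∀ {k : ℕ} (M : Matrix (Fin k) (Fin k) ℝ), M.charpoly ≠ 0 := fun M =>
    M.charpoly_monic.ne_zero
  -- The two characteristic polynomials agree up to powers of the variable; the extra zero roots
  -- contribute `φ 0 = 0`.
  have hT : ((X * Xᵀ).charpoly.roots.map fun x => φ √x).sum =
      ((Xᵀ * X).charpoly.roots.map fun x => φ √x).sum := by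
    have h := congrArg (fun p : Polynomial ℝ => (p.roots.map fun x => φ √x).sum)
      (charpoly_mul_comm' X Xᵀ)
    simpa [Polynomial.roots_mul, hne, Multiset.map_nsmul, Multiset.sum_nsmul, h0] using h
  rw [hL, hsq, charpoly_fromBlocks_zero₁₂, Polynomial.roots_mul (mul_ne_zero (hne _) (hne _)),
    Multiset.map_add, Multiset.sum_add, hT, hR, sum_range_sigma h0, two_mul]

end Dilation

/-! ### The even residual on the real line. -/

section Scalar

/-- The even extension to `ℝ` of `κ(t) - κ'(0) t`. -/
noncomputable def evenResidual (κ : ℝ → ℝ) (t : ℝ) : ℝ := κ |t| - slopeOn κ 0 * |t|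

/-- The derivative of `evenResidual κ`. -/
noncomputable def evenResidualDeriv (κ : ℝ → ℝ) (t : ℝ) : ℝ :=
  if 0 ≤ t then slopeOn κ t - slopeOn κ 0 else -(slopeOn κ (-t) - slopeOn κ 0)

namespace IsPenalty

variable {κ : ℝ → ℝ} {ρ : ℝ}

theorem rho_nonneg (h : IsPenalty κ ρ) : 0 ≤ ρ := by
  simpa using (abs_nonneg _).trans (h.lipschitz 1 0 zero_le_one le_rfl)

theorem slopeOn_antitone (h : IsPenalty κ ρ) : AntitoneOn (slopeOn κ) (Set.Ici 0) :=
  h.concave.antitoneOn_derivWithin h.differentiable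

theorem slopeOn_zero_nonneg (h : IsPenalty κ ρ) : 0 ≤ slopeOn κ 0 :=
  h.mono.derivWithin_nonneg

theorem evenResidualDeriv_antitone (h : IsPenalty κ ρ) : Antitone (evenResidualDeriv κ) := by
  have key : ∀ s, 0 ≤ s → slopeOn κ s ≤ slopeOn κ 0 := fun s hs =>
    h.slopeOn_antitone (Set.mem_Ici.2 le_rfl) hs hs
  intro s t hst
  unfold evenResidualDeriv
  split_ifs with h1 h2 h2
  · linarith [h.slopeOn_antitone (Set.mem_Ici.2 h2) (Set.mem_Ici.2 h1) hst]
  · linarith [key t h1, key (-s) (by linarith)]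
  · linarith
  · linarith [h.slopeOn_antitone (a := -t) (b := -s) (Set.mem_Ici.2 (by linarith))
      (Set.mem_Ici.2 (by linarith)) (by linarith)]

theorem evenResidualDeriv_lipschitz (h : IsPenalty κ ρ) (s t : ℝ) :
    |evenResidualDeriv κ s - evenResidualDeriv κ t| ≤ ρ * |s - t| := by
  -- For opposite signs, compare each slope with the one at `0`: the distances `s` and `-t` add up
  -- to `s - t`.
  have opp : ∀ s t, 0 ≤ s → t < 0 →
      |slopeOn κ s - slopeOn κ 0 - -(slopeOn κ (-t) - slopeOn κ 0)| ≤ ρ * |s - t| := by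
    intro s t hs ht
    have h1 := h.lipschitz s 0 hs le_rfl
    have h2 := h.lipschitz (-t) 0 (by linarith) le_rfl
    rw [sub_zero, abs_of_nonneg hs] at h1
    rw [sub_zero, abs_of_pos (neg_pos.2 ht)] at h2
    rw [abs_of_nonneg (by linarith : 0 ≤ s - t), sub_neg_eq_add]
    exact (abs_add_le _ _).trans (by linarith)
  unfold evenResidualDeriv
  split_ifs with h1 h2 h2
  · simpa using h.lipschitz s t h1 h2
  · exact opp s t h1 (not_le.1 h2)
  · rw [abs_sub_comm, abs_sub_comm s]
    exact opp t s h2 (not_le.1 h1)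
  · have := h.lipschitz (-t) (-s) (by linarith) (by linarith)
    rw [show -t - -s = s - t by ring] at this
    rwa [show -(slopeOn κ (-s) - slopeOn κ 0) - -(slopeOn κ (-t) - slopeOn κ 0) =
      slopeOn κ (-t) - slopeOn κ (-s) by ring]

theorem hasDerivWithinAt_residual (h : IsPenalty κ ρ) {t : ℝ} (ht : 0 ≤ t) :
    HasDerivWithinAt (evenResidual κ) (slopeOn κ t - slopeOn κ 0) (Set.Ici 0) t := by
  have h1 : HasDerivWithinAt (fun t => κ t - slopeOn κ 0 * t) (slopeOn κ t - slopeOn κ 0)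
      (Set.Ici 0) t := by
    have h2 := (hasDerivWithinAt_id t (Set.Ici (0 : ℝ))).const_mul (slopeOn κ 0)
    rw [mul_one] at h2
    exact (h.differentiable t ht).hasDerivWithinAt.sub h2
  exact h1.congr (fun x hx => by rw [evenResidual, abs_of_nonneg hx])
    (by rw [evenResidual, abs_of_nonneg ht])

theorem hasDerivWithinAt_residual_neg (h : IsPenalty κ ρ) {t : ℝ} (ht : t ≤ 0) :
    HasDerivWithinAt (evenResidual κ) (-(slopeOn κ (-t) - slopeOn κ 0)) (Set.Iic 0) t := by
  have h1 := (h.hasDerivWithinAt_residual (neg_nonneg.2 ht)).comp t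
    (hasDerivWithinAt_neg t (Set.Iic 0)) (fun x hx => Set.mem_Ici.2 (neg_nonneg.2 hx))
  have h2 : evenResidual κ ∘ Neg.neg = evenResidual κ := by ext x; simp [evenResidual]
  rw [mul_neg_one] at h1
  exact h2 ▸ h1

theorem hasDerivAt_evenResidual (h : IsPenalty κ ρ) (t : ℝ) :
    HasDerivAt (evenResidual κ) (evenResidualDeriv κ t) t := by
  unfold evenResidualDeriv
  rcases lt_trichotomy t 0 with ht | rfl | ht
  · rw [if_neg (not_le.2 ht)]
    exact (h.hasDerivWithinAt_residual_neg ht.le).hasDerivAt (Iic_mem_nhds ht)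
  -- Both one-sided derivatives at `0` vanish, which is why the slope `κ'(0)` was subtracted.
  · have h1 := h.hasDerivWithinAt_residual le_rfl
    have h2 := h.hasDerivWithinAt_residual_neg le_rfl
    simp only [neg_zero, sub_self] at h1 h2
    simpa using (h1.union h2)
  · rw [if_pos ht.le]
    exact (h.hasDerivWithinAt_residual ht.le).hasDerivAt (Ici_mem_nhds ht)

/-- The first-order remainder of the even residual is nonpositive and at most quadratic. -/
theorem evenResidual_remainder (h : IsPenalty κ ρ) (s t : ℝ) :
    evenResidual κ t - evenResidual κ s - evenResidualDeriv κ s * (t - s) ≤ 0 ∧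
      -(ρ * (t - s) ^ 2) ≤
        evenResidual κ t - evenResidual κ s - evenResidualDeriv κ s * (t - s) := by
  have hc : Continuous (evenResidual κ) :=
    continuous_iff_continuousAt.2 fun t => (h.hasDerivAt_evenResidual t).continuousAt
  rcases lt_trichotomy s t with hst | rfl | hst
  -- By the mean value theorem the remainder is the derivative increment from `s` to `c`, times `t -
  -- s`. Antitonicity gives its sign and the Lipschitz bound its size. The constant `ρ` instead of
  -- `ρ / 2` is harmless: the quadratic bound serves only to prove differentiability.
  · obtain ⟨c, ⟨hc1, hc2⟩, hc3⟩ := exists_hasDerivAt_eq_slope _ _ hst hc.continuousOn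
      fun x _ => h.hasDerivAt_evenResidual x
    have e := (eq_div_iff (sub_pos.2 hst).ne').1 hc3
    have h1 := h.evenResidualDeriv_antitone hc1.le
    have h2 := (abs_le.1 (h.evenResidualDeriv_lipschitz c s)).1
    rw [abs_of_pos (sub_pos.2 hc1)] at h2
    have h3 := mul_le_mul_of_nonneg_left (sub_le_sub_right hc2.le s) h.rho_nonneg
    rw [← e, ← sub_mul]
    constructor <;> nlinarith
  · simp
  · obtain ⟨c, ⟨hc1, hc2⟩, hc3⟩ := exists_hasDerivAt_eq_slope _ _ hst hc.continuousOn
      fun x _ => h.hasDerivAt_evenResidual x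
    have e := (eq_div_iff (sub_pos.2 hst).ne').1 hc3
    have h1 := h.evenResidualDeriv_antitone hc2.le
    have h2 := (abs_le.1 (h.evenResidualDeriv_lipschitz c s)).2
    rw [abs_of_neg (sub_neg.2 hc2)] at h2
    have h3 := mul_le_mul_of_nonneg_left (by linarith : -(c - s) ≤ s - t) h.rho_nonneg
    have e' : evenResidual κ t - evenResidual κ s - evenResidualDeriv κ s * (t - s) =
      (evenResidualDeriv κ c - evenResidualDeriv κ s) * (t - s) := by linear_combination e
    rw [e']
    constructor <;> nlinarith

end IsPenalty

end Scalar

/-! ### Calculus of half-trace functions and the nuclear norm. -/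

section SpectralFunctions

open Matrix

variable {m n : ℕ}

/-- The linear functional `H ↦ ⟨G, H⟩ = ∑ᵢⱼ Gᵢⱼ Hᵢⱼ`. -/
noncomputable def frobeniusPairing (G : Matrix (Fin m) (Fin n) ℝ) :
    Matrix (Fin m) (Fin n) ℝ →ₗ[ℝ] ℝ where
  toFun H := ∑ i, ∑ j, G i j * H i j
  map_add' := by simp [mul_add, Finset.sum_add_distrib]
  map_smul' := by simp [Finset.mul_sum, mul_left_comm]

theorem frobeniusPairing_apply (G H : Matrix (Fin m) (Fin n) ℝ) :
    frobeniusPairing G H = ∑ i, ∑ j, G i j * H i j := rfl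

/-- Half the trace of `f` of the dilation. -/
noncomputable def halfTrace (f : ℝ → ℝ) (X : Matrix (Fin m) (Fin n) ℝ) : ℝ :=
  (∑ k, f ((dilation_isHermitian X).eigenvalues k)) / 2

/-- The gradient of `halfTrace f`, where `d` is the derivative of `f`. -/
noncomputable def halfTraceGrad (d : ℝ → ℝ) (X : Matrix (Fin m) (Fin n) ℝ) :
    Matrix (Fin m) (Fin n) ℝ :=
  ((dilation_isHermitian X).cfc d).toBlocks₁₂

theorem halfTrace_remainder (f d : ℝ → ℝ) (X Y : Matrix (Fin m) (Fin n) ℝ) :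
    halfTrace f Y - halfTrace f X - frobeniusPairing (halfTraceGrad d X) (Y - X) =
      (∑ i, ∑ j, (f ((dilation_isHermitian Y).eigenvalues j) -
        f ((dilation_isHermitian X).eigenvalues i) - d ((dilation_isHermitian X).eigenvalues i) *
          ((dilation_isHermitian Y).eigenvalues j - (dilation_isHermitian X).eigenvalues i)) *
            eigenOverlap (dilation_isHermitian X) (dilation_isHermitian Y) i j) / 2 := by
  rw [← sum_eigenvalues_sub_sub_trace, ← dilation_sub, trace_mul_dilation (cfc_transpose _ _)]
  simp only [halfTrace, frobeniusPairing_apply, halfTraceGrad]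
  ring

theorem sum_sq_eigenOverlap_dilation (X Y : Matrix (Fin m) (Fin n) ℝ) :
    ∑ i, ∑ j, ((dilation_isHermitian Y).eigenvalues j - (dilation_isHermitian X).eigenvalues i) ^ 2
      * eigenOverlap (dilation_isHermitian X) (dilation_isHermitian Y) i j = 2 * ‖Y - X‖ ^ 2 := by
  rw [norm_sub_rev, ← trace_dilation_mul_self, dilation_sub,
    trace_sub_sq (dilation_isHermitian X) (dilation_isHermitian Y)]
  simp only [sub_sq_comm]

theorem halfTrace_remainder_nonneg {f d : ℝ → ℝ} (h : ∀ s t, 0 ≤ f t - f s - d s * (t - s))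
    (X Y : Matrix (Fin m) (Fin n) ℝ) :
    0 ≤ halfTrace f Y - halfTrace f X - frobeniusPairing (halfTraceGrad d X) (Y - X) := by
  rw [halfTrace_remainder]
  exact div_nonneg (Finset.sum_nonneg fun i _ => Finset.sum_nonneg fun j _ =>
    mul_nonneg (h _ _) (eigenOverlap_nonneg _ _ _ _)) zero_le_two

theorem halfTrace_remainder_nonpos {f d : ℝ → ℝ} (h : ∀ s t, f t - f s - d s * (t - s) ≤ 0)
    (X Y : Matrix (Fin m) (Fin n) ℝ) :
    halfTrace f Y - halfTrace f X - frobeniusPairing (halfTraceGrad d X) (Y - X) ≤ 0 := by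
  rw [halfTrace_remainder]
  exact div_nonpos_of_nonpos_of_nonneg (Finset.sum_nonpos fun i _ => Finset.sum_nonpos fun j _ =>
    mul_nonpos_of_nonpos_of_nonneg (h _ _) (eigenOverlap_nonneg _ _ _ _)) zero_le_two

theorem abs_halfTrace_remainder_le {f d : ℝ → ℝ} {L : ℝ}
    (h : ∀ s t, |f t - f s - d s * (t - s)| ≤ L * (t - s) ^ 2)
    (X Y : Matrix (Fin m) (Fin n) ℝ) :
    |halfTrace f Y - halfTrace f X - frobeniusPairing (halfTraceGrad d X) (Y - X)| ≤
      L * ‖Y - X‖ ^ 2 := by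
  have e : L * ‖Y - X‖ ^ 2 = L * (2 * ‖Y - X‖ ^ 2) / 2 := by ring
  rw [halfTrace_remainder, abs_div, abs_two, e, ← sum_sq_eigenOverlap_dilation, Finset.mul_sum]
  refine div_le_div_of_nonneg_right ((Finset.abs_sum_le_sum_abs _ _).trans
    (Finset.sum_le_sum fun i _ => ?_)) zero_le_two
  rw [Finset.mul_sum]
  refine (Finset.abs_sum_le_sum_abs _ _).trans (Finset.sum_le_sum fun j _ => ?_)
  rw [abs_mul, abs_of_nonneg (eigenOverlap_nonneg _ _ _ _), ← mul_assoc]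
  exact mul_le_mul_of_nonneg_right (h _ _) (eigenOverlap_nonneg _ _ _ _)

theorem hasFDerivAt_halfTrace {f d : ℝ → ℝ} {L : ℝ}
    (h : ∀ s t, |f t - f s - d s * (t - s)| ≤ L * (t - s) ^ 2) (X : Matrix (Fin m) (Fin n) ℝ) :
    HasFDerivAt (halfTrace f) (frobeniusPairing (halfTraceGrad d X)).toContinuousLinearMap X := by
  refine hasFDerivAt_iff_isLittleO.2 ?_
  refine Asymptotics.IsBigO.trans_isLittleO (g := fun Y => ‖Y - X‖ ^ 2) ?_
    (Asymptotics.isLittleO_pow_sub_sub X one_lt_two)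
  refine Asymptotics.IsBigO.of_bound L (Filter.Eventually.of_forall fun Y => ?_)
  rw [Real.norm_eq_abs, Real.norm_eq_abs, abs_of_nonneg (sq_nonneg ‖Y - X‖)]
  exact abs_halfTrace_remainder_le h X Y

/-- The dilation doubles squared Frobenius norms; this factor cancels against the one from the two
off-diagonal blocks, so the scalar Lipschitz constant survives. -/
theorem norm_halfTraceGrad_sub_le {d : ℝ → ℝ} {L : ℝ} (hL : 0 ≤ L)
    (h : ∀ s t, |d s - d t| ≤ L * |s - t|) (X Y : Matrix (Fin m) (Fin n) ℝ) :
    ‖halfTraceGrad d X - halfTraceGrad d Y‖ ≤ L * ‖X - Y‖ := by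
  have hX := dilation_isHermitian X
  have hY := dilation_isHermitian Y
  have h1 : 2 * ‖halfTraceGrad d X - halfTraceGrad d Y‖ ^ 2 ≤ _ :=
    two_mul_norm_toBlocks₁₂_sq_le (M := hX.cfc d - hY.cfc d)
      (by rw [transpose_sub, cfc_transpose, cfc_transpose])
  have h2 := trace_cfc_sub_cfc_sq_le hX hY h
  rw [← dilation_sub, trace_dilation_mul_self] at h2
  refine le_of_sq_le_sq ?_ (by positivity)
  rw [mul_pow]
  linarith

theorem convexOn_of_forall_affine_le {E : Type*} [AddCommGroup E] [Module ℝ E] {F : E → ℝ}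
    (h : ∀ x, ∃ l : E →ₗ[ℝ] ℝ, ∀ y, 0 ≤ F y - F x - l (y - x)) : ConvexOn ℝ Set.univ F := by
  refine ⟨convex_univ, fun x _ y _ a b ha hb hab => ?_⟩
  -- The supporting functional at the convex combination cancels when the two inequalities are
  -- averaged.
  obtain ⟨l, hl⟩ := h (a • x + b • y)
  have hx := mul_nonneg ha (hl x)
  have hy := mul_nonneg hb (hl y)
  simp only [map_sub, map_add, map_smul, smul_eq_mul] at hx hy ⊢
  have hb' : b = 1 - a := by linarith
  subst hb'
  linarith

theorem halfTrace_eq_sum_sigma {φ : ℝ → ℝ} (h0 : φ 0 = 0) (X : Matrix (Fin m) (Fin n) ℝ) :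
    halfTrace (fun t => φ |t|) X = ∑ i ∈ Finset.range (min m n), φ (sigma X i) := by
  rw [halfTrace, sum_eigenvalues_dilation h0]
  ring

theorem nuclearNorm_eq_halfTrace (X : Matrix (Fin m) (Fin n) ℝ) :
    nuclearNorm X = halfTrace (fun t => |t|) X :=
  (halfTrace_eq_sum_sigma (φ := id) rfl X).symm

theorem gBar_eq_halfTrace {κ : ℝ → ℝ} (h0 : κ 0 = 0) (μ : ℝ) :
    (gBar κ μ : Matrix (Fin m) (Fin n) ℝ → ℝ) = fun X => μ * halfTrace (evenResidual κ) X := by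
  funext X
  have h : halfTrace (evenResidual κ) X = _ :=
    halfTrace_eq_sum_sigma (φ := fun s => κ s - slopeOn κ 0 * s) (by simp [h0]) X
  rw [h, gBar, nuclearNorm, Finset.sum_sub_distrib, ← Finset.mul_sum]
  ring

theorem convexOn_nuclearNorm :
    ConvexOn ℝ Set.univ (nuclearNorm : Matrix (Fin m) (Fin n) ℝ → ℝ) := by
  refine convexOn_of_forall_affine_le fun X =>
    -- The sign is a subgradient of `|·|` everywhere, with value `0` at `0`.
    ⟨frobeniusPairing (halfTraceGrad (fun t => (SignType.sign t : ℝ)) X), fun Y => ?_⟩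
  rw [nuclearNorm_eq_halfTrace, nuclearNorm_eq_halfTrace]
  refine halfTrace_remainder_nonneg (fun s t => ?_) X Y
  rcases lt_trichotomy s 0 with hs | rfl | hs
  · simp only [sign_neg hs, abs_of_neg hs, SignType.coe_neg_one]
    linarith [neg_abs_le t]
  · simp
  · simp only [sign_pos hs, abs_of_pos hs, SignType.coe_one]
    linarith [le_abs_self t]

/-- With `λ` the eigenvalues of the dilation, `2‖X‖² = ∑ λ² ≤ (∑ |λ|)²`. The factor is not sharp;
only linear growth at the origin is needed. -/
theorem norm_le_nuclearNorm_mul_two (X : Matrix (Fin m) (Fin n) ℝ) :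
    ‖X‖ ≤ 2 * nuclearNorm X := by
  have h1 := trace_mul_self_eq_sum_sq_eigenvalues (dilation_isHermitian X)
  rw [trace_dilation_mul_self] at h1
  have h2 : 2 * nuclearNorm X = ∑ k, |(dilation_isHermitian X).eigenvalues k| := by
    rw [nuclearNorm_eq_halfTrace, halfTrace]
    ring
  have h3 : ∑ k, |(dilation_isHermitian X).eigenvalues k| ^ 2 ≤
      (∑ k, |(dilation_isHermitian X).eigenvalues k|) ^ 2 :=
    Finset.sum_sq_le_sq_sum_of_nonneg fun _ _ => abs_nonneg _
  simp only [sq_abs] at h3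
  rw [h2]
  refine le_of_sq_le_sq ?_ (Finset.sum_nonneg fun _ _ => abs_nonneg _)
  linarith [sq_nonneg ‖X‖]

theorem nuclearNorm_zero : nuclearNorm (0 : Matrix (Fin m) (Fin n) ℝ) = 0 := by
  simp [nuclearNorm, sigma]

theorem not_differentiableAt_nuclearNorm_zero (hm : 0 < m) (hn : 0 < n) :
    ¬ DifferentiableAt ℝ (nuclearNorm : Matrix (Fin m) (Fin n) ℝ → ℝ) 0 := by
  intro hd
  have hmin : IsLocalMin (nuclearNorm : Matrix (Fin m) (Fin n) ℝ → ℝ) 0 :=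
    Filter.Eventually.of_forall fun X => by
      rw [nuclearNorm_zero]
      linarith [norm_le_nuclearNorm_mul_two X, norm_nonneg X]
  have h := hd.hasFDerivAt
  rw [hmin.hasFDerivAt_eq_zero h] at h
  set E : Matrix (Fin m) (Fin n) ℝ := of fun _ _ => 1 with hE
  have hE0 : 0 < ‖E‖ := norm_pos_iff.2 fun h0 => by
    simpa [hE] using congrFun (congrFun h0 ⟨0, hm⟩) ⟨0, hn⟩
  -- Any constant below `1 / 2` contradicts `‖X‖ ≤ 2 * nuclearNorm X` for small nonzero `X`.
  have hb := (hasFDerivAt_iff_isLittleO_nhds_zero.1 h).bound (c := 1 / 4) (by norm_num)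
  simp only [nuclearNorm_zero, zero_add, sub_zero, _root_.zero_apply] at hb
  have ht : Filter.Tendsto (fun t : ℝ => t • E) (nhdsWithin 0 (Set.Ioi 0)) (nhds 0) := by
    have : Filter.Tendsto (fun t : ℝ => t • E) (nhds 0) (nhds ((0 : ℝ) • E)) :=
      (continuous_id.smul continuous_const).tendsto 0
    rw [zero_smul] at this
    exact this.mono_left nhdsWithin_le_nhds
  obtain ⟨t, h1, h2⟩ := ((ht.eventually hb).and self_mem_nhdsWithin).exists
  have h3 : 0 < ‖t • E‖ := by
    rw [norm_smul]
    exact mul_pos (norm_pos_iff.2 (ne_of_gt h2)) hE0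
  linarith [norm_le_nuclearNorm_mul_two (t • E), le_abs_self (nuclearNorm (t • E)),
    Real.norm_eq_abs (nuclearNorm (t • E))]

end SpectralFunctions

theorem LipschitzSmooth.mono {m n : ℕ} {f : Matrix (Fin m) (Fin n) ℝ → ℝ} {L L' : ℝ}
    (h : LipschitzSmooth f L) (hL : L ≤ L') : LipschitzSmooth f L' := by
  obtain ⟨grad, h1, h2⟩ := h
  exact ⟨grad, h1, fun X Y => (h2 X Y).trans (mul_le_mul_of_nonneg_right hL (norm_nonneg _))⟩

/-! ### Concavity and smoothness of the concave part. -/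

namespace IsPenalty

variable {m n : ℕ} {κ : ℝ → ℝ} {ρ μ : ℝ}

theorem concaveOn_gBar (hκ : IsPenalty κ ρ) (hμ : 0 ≤ μ) :
    ConcaveOn ℝ Set.univ (gBar κ μ : Matrix (Fin m) (Fin n) ℝ → ℝ) := by
  rw [gBar_eq_halfTrace hκ.map_zero, ← neg_convexOn_iff]
  refine convexOn_of_forall_affine_le fun X =>
    ⟨-(μ • frobeniusPairing (halfTraceGrad (evenResidualDeriv κ) X)), fun Y => ?_⟩
  have h := mul_nonneg hμ (neg_nonneg.2 (halfTrace_remainder_nonpos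
    (fun s t => (hκ.evenResidual_remainder s t).1) X Y))
  simp only [Pi.neg_apply, LinearMap.neg_apply, LinearMap.smul_apply, smul_eq_mul]
  linarith

/-- The sharp smoothness constant of the concave part. -/
theorem lipschitzSmooth_gBar (hκ : IsPenalty κ ρ) (hμ : 0 ≤ μ) :
    LipschitzSmooth (gBar κ μ : Matrix (Fin m) (Fin n) ℝ → ℝ) (μ * ρ) := by
  rw [gBar_eq_halfTrace hκ.map_zero]
  refine ⟨fun X => μ • halfTraceGrad (evenResidualDeriv κ) X, fun X => ⟨_, fun H => ?_,
    (hasFDerivAt_halfTrace (d := evenResidualDeriv κ) (L := ρ) (fun s t => ?_) X).const_mul μ⟩,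
    fun X Y => ?_⟩
  · change μ * frobeniusPairing _ H = _
    simp [frobeniusPairing_apply, Finset.mul_sum, mul_assoc]
  · obtain ⟨h1, h2⟩ := hκ.evenResidual_remainder s t
    exact abs_le.2 ⟨h2, h1.trans (mul_nonneg hκ.rho_nonneg (sq_nonneg _))⟩
  · rw [← smul_sub, norm_smul, Real.norm_of_nonneg hμ, mul_assoc]
    exact mul_le_mul_of_nonneg_left
      (norm_halfTraceGrad_sub_le hκ.rho_nonneg hκ.evenResidualDeriv_lipschitz X Y) hμ

end IsPenalty

theorem proposition2 (m n : ℕ) (κ : ℝ → ℝ) (ρ μ : ℝ) (hκ : IsPenalty κ ρ) (hμ : 0 ≤ μ) :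
    (∀ X : Matrix (Fin m) (Fin n) ℝ, gReg κ μ X = gBar κ μ X + gBreve κ μ X) ∧
    ConcaveOn ℝ Set.univ (gBar κ μ : Matrix (Fin m) (Fin n) ℝ → ℝ) ∧
    LipschitzSmooth (gBar κ μ : Matrix (Fin m) (Fin n) ℝ → ℝ) (2 * μ * ρ) ∧
    (μ ≤ 2 → LipschitzSmooth (gBar κ μ : Matrix (Fin m) (Fin n) ℝ → ℝ) (2 * ρ)) ∧
    ConvexOn ℝ Set.univ (gBreve κ μ : Matrix (Fin m) (Fin n) ℝ → ℝ) ∧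
    (0 < m → 0 < n → 0 < μ → 0 < slopeOn κ 0 →
      ¬ Differentiable ℝ (gBreve κ μ : Matrix (Fin m) (Fin n) ℝ → ℝ)) := by
  have hs := hκ.lipschitzSmooth_gBar (m := m) (n := n) hμ
  have hρ := hκ.rho_nonneg
  refine ⟨fun X => by simp [gReg, gBar, gBreve], hκ.concaveOn_gBar hμ,
    hs.mono (by linarith [mul_nonneg hμ hρ]), fun h => hs.mono (mul_le_mul_of_nonneg_right h hρ),
    convexOn_nuclearNorm.smul (mul_nonneg hμ hκ.slopeOn_zero_nonneg), ?_⟩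
  intro hm hn hμ0 hκ0 hd
  refine not_differentiableAt_nuclearNorm_zero hm hn ?_
  have h := (hd 0).const_mul (μ * slopeOn κ 0)⁻¹
  refine h.congr_of_eventuallyEq (Filter.Eventually.of_forall fun X => ?_)
  exact (inv_mul_cancel_left₀ (mul_pos hμ0 hκ0).ne' _).symm
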